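/- **Conventions.** For a real $d\times m$ matrix $A$, $\sigma_1(A)\ge\sigma_2(A)\ge\cdots$ are its singular values, with $\sigma_i(A)=0$ for $i>\min\{d,m\}$; $\|A\|_2$ is the spectral norm; $\sigma_{\min}(A)=\sigma_{\min\{d,m\}}(A)$ and $\kappa(A)=\sigma_1(A)/\sigma_{\min}(A)$. **Algorithm.** Given $A\in\mathbb R^{d\times m}$ and $k \le m$, SPA starts with $S=A$, $\mathcal I=\emptyset$ and, as long as $|\mathcal I|<k$, picks a column $t=s_{i^*}$ of $S$ of largest Euclidean norm (ties broken arbitrarily), replaces $S$ by $(I-tt^\top/\|t\|_2^2)S$ and $\mathcal I$ by $\mathcal I\cup\{i^*\}$; its output is $\mathcal I$. The SPA-based rank-$k$ approximation of $A$ with an integer parameter $q\ge 0$ takes an output $\mathcal I$ of SPA on $(A,k)$, forms $Y=(AA^\top)^qA(\mathcal I)$, where $A(\mathcal I)$ consists of the columns of $A$ with index in $\mathcal I$, takes a matrix $Q$ whose columns form an orthonormal basis of the range of $Y$, and returns $B=QQ^\top A$. **Theorem.** Let $k\ge 2$, $q\ge 0$ be integers and let $A=M+N$ with $M,N\in\mathbb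 R^{d\times m}$. Suppose that $M=F[I,H]\Pi$, where $F\in\mathbb R^{d\times k}$ has rank $k$, $I$ is the $k\times k$ identity matrix, $H$ is a nonnegative $k\times(m-k)$ matrix all of whose column sums are at most $1$, and $\Pi$ is an $m\times m$ permutation matrix. Suppose also that $$\|N\|_2<\min\Bigl\{\frac1{2\sqrt{k-1}},\frac14\Bigr\}\,\frac{\sigma_{\min}(F)}{1+80\,\kappa(F)^2}.$$ Write $\sigma_i=\sigma_i(A)$. Then every output $B$ of the SPA-based rank-$k$ approximation of $A$ with parameter $q$ satisfies the following. (a) If $q\ge 1$ and $\sigma_{k+1}>0$, then $$\|A-B\|_2<\sigma_{k+1}\sqrt{1+\frac1{20164}\Bigl(\frac{\sigma_{k+1}}{\sigma_k}\Bigr)^{4q-2}}.$$ If $\sigma_{k+1}=0$ (for any $q\ge 0$), then $B=A$. (b) $\operatorname{rank}(B)=k$ (for any $q\ge 0$). -/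

import Mathlib

open scoped Matrix Matrix.Norms.L2Operator

namespace SPA

noncomputable section

/-- The `i`-th largest singular value `σ_i(A)` of a real `d × m` matrix, counted from `i = 1`
(Mathlib counts from `0`). It is `0` for `i > min d m`. -/
def sigma {d m : ℕ} (A : Matrix (Fin d) (Fin m) ℝ) (i : ℕ) : ℝ :=
  (Matrix.toEuclideanLin A).singularValues (i - 1)

/-- The largest singular value. -/
def sigmaMax {d m : ℕ} (A : Matrix (Fin d) (Fin m) ℝ) : ℝ := sigma A 1

/-- The smallest of the singular values `σ_1, …, σ_t`, `t = min d m`. -/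
def sigmaMin {d m : ℕ} (A : Matrix (Fin d) (Fin m) ℝ) : ℝ := sigma A (min d m)

/-- The condition number `κ(A) = σ_max(A) / σ_min(A)`. -/
def cond {d m : ℕ} (A : Matrix (Fin d) (Fin m) ℝ) : ℝ := sigmaMax A / sigmaMin A

/-- `M = F [I, H] Π` with `rank F = k`, `H` a nonnegative `k × (m - k)` matrix whose column sums
are at most `1`, and `Π` a permutation matrix. The columns of `[I, H]` are indexed by
`Fin k ⊕ Fin (m - k)`; the bijection `e` with `Fin m` says where `Π` puts each of them
(in particular `k ≤ m`). -/
def IsSeparable {d m k : ℕ} (M : Matrix (Fin d) (Fin m) ℝ) (F : Matrix (Fin d) (Fin k) ℝ) :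
    Prop :=
  F.rank = k ∧
  ∃ (H : Matrix (Fin k) (Fin (m - k)) ℝ) (e : Fin k ⊕ Fin (m - k) ≃ Fin m),
    (∀ i j, 0 ≤ H i j) ∧ (∀ j, ∑ i, H i j ≤ 1) ∧
    M = F * (Matrix.fromCols (1 : Matrix (Fin k) (Fin k) ℝ) H).submatrix id e.symm

/-- The squared Euclidean norm of a vector of `ℝ^d`. -/
def normSq {d : ℕ} (v : Fin d → ℝ) : ℝ := ∑ i, v i ^ 2

/-- `Reach A k S I`: the successive projection algorithm on the input `(A, k)` can arrive at the
current matrix `S` and the current index set `I`. One pass of the loop picks a column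
`t = s_j` of `S` of largest norm (with any choice among ties), replaces `S` by
`(1 - t tᵀ / ‖t‖²) S` and adds `j` to `I`; passes are made as long as `|I| < k`. -/
inductive Reach {d m : ℕ} (A : Matrix (Fin d) (Fin m) ℝ) (k : ℕ) :
    Matrix (Fin d) (Fin m) ℝ → Finset (Fin m) → Prop
  | init : Reach A k A ∅
  | step (S : Matrix (Fin d) (Fin m) ℝ) (I : Finset (Fin m)) (j : Fin m)
      (hS : Reach A k S I) (hI : I.card < k)
      (hj : ∀ l, normSq (S.col l) ≤ normSq (S.col j)) :
      Reach A k
        ((1 - (normSq (S.col j))⁻¹ • Matrix.vecMulVec (S.col j) (S.col j)) * S)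
        (insert j I)

/-- `I` is a possible output of the successive projection algorithm on the input `(A, k)`. -/
def IsSPAOutput {d m : ℕ} (A : Matrix (Fin d) (Fin m) ℝ) (k : ℕ) (I : Finset (Fin m)) : Prop :=
  I.card = k ∧ ∃ S, Reach A k S I

/-- The submatrix `A(I)` of the columns of `A` with index in `I`. -/
def colSubmatrix {d m : ℕ} (A : Matrix (Fin d) (Fin m) ℝ) (I : Finset (Fin m)) :
    Matrix (Fin d) I ℝ :=
  A.submatrix id (fun i : I => (i : Fin m))

/-- `B` is a possible output of the SPA based rank-`k` approximation on the input `A`, `q`, `k`: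
for an output `I` of SPA on `(A, k)`, with `Y = (A Aᵀ)^q A(I)`, and for a matrix `Q` whose columns
form an orthonormal basis of the range of `Y`, one has `B = Q Qᵀ A`. -/
def IsApproxOutput {d m : ℕ} (A : Matrix (Fin d) (Fin m) ℝ) (q k : ℕ)
    (B : Matrix (Fin d) (Fin m) ℝ) : Prop :=
  ∃ I : Finset (Fin m), IsSPAOutput A k I ∧
    ∃ (r : ℕ) (Q : Matrix (Fin d) (Fin r) ℝ),
      Qᵀ * Q = 1 ∧
      LinearMap.range Q.mulVecLin =
        LinearMap.range ((A * Aᵀ) ^ q * colSubmatrix A I).mulVecLin ∧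
      B = Q * Qᵀ * A

end

end SPA

/-!
The theorem has two halves: the successive projection algorithm finds well conditioned columns, and
a power iteration started from such columns is nearly optimal.

*Selection.* Write `ε = ‖N‖`, `σ = σ_min(F)` and `K = σ_max(F)`. Every column of `A` is, up to an
error `ε`, a subconvex combination of the columns of `F`, and every column of `F` occurs among those
of `A`, up to `ε`. Suppose that the columns selected so far are within `δ = ε (1 + 64/3 (K/σ)²)` of
distinct columns of `F`, and let `P` project them away. The columns of `F` not yet represented stay
well conditioned under `P` (`deflated_lower_bound`), while the represented ones become short. The
next selected column `P F h + P n` is, up to `2ε`, as long as the longest `P f_i`. By strict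
convexity of the ball this forces `h` to have almost all its weight on one index
(`exists_dominant_weight`), with an error linear in `ε`; hence the new column is again within `δ` of
a column of `F`, with the same `δ` (`exists_near_of_maximal_projection`). By induction `A(I)` is a
permutation of `F` up to `δ` in each column (`Reach.exists_labels`), so that `A` is bounded below by
`3σ/4` on the vectors supported on `I` (`IsSPAOutput.norm_le_norm_toEuclideanLin`).

*Power iteration.* Since `rank M ≤ k`, the singular value `σ_{k+1}(A)` is at most `ε`
(`singularValues_le_of_add`), which is far below `3σ/4`. Therefore the leading part of `A c`
dominates its tail for every `c` supported on `I`, and `c` can be chosen such that the leading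
coordinates of `(AᵀA)^q c` are those of a given `x`. The tail is damped by the powers of the singular
values, which bounds the distance from `A x` to the range of `(AAᵀ)^q A(I)`
(`exists_mem_norm_sub_iterate_sq_le`). As `Q Qᵀ` projects orthogonally onto this range, that distance
bounds `‖(A - B) x‖`. The lower bound on `A(I)` also makes `(AAᵀ)^q A(I)` injective, which gives the
rank of `B` and the equality `B = A` when `A` has rank at most `k`.
-/

namespace SPA


/-! ### Singular values in an eigenbasis -/

section Spectral

open Module

variable {V W : Type*} [NormedAddCommGroup V] [InnerProductSpace ℝ V] [FiniteDimensional ℝ V]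
  [NormedAddCommGroup W] [InnerProductSpace ℝ W] [FiniteDimensional ℝ W]

/-- An orthonormal basis of eigenvectors of `T* T`, that is, of right singular vectors of `T`,
ordered by decreasing singular value. -/
noncomputable def rightSingularBasis (T : V →ₗ[ℝ] W) :
    OrthonormalBasis (Fin (finrank ℝ V)) ℝ V :=
  T.isSymmetric_adjoint_comp_self.eigenvectorBasis rfl

theorem repr_adjoint_comp_self (T : V →ₗ[ℝ] W) (x : V) (i : Fin (finrank ℝ V)) :
    (rightSingularBasis T).repr ((T.adjoint ∘ₗ T) x) i =
      T.singularValues i ^ 2 * (rightSingularBasis T).repr x i := by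
  rw [T.sq_singularValues_fin rfl]
  exact T.isSymmetric_adjoint_comp_self.eigenvectorBasis_apply_self_apply rfl x i

theorem repr_adjoint_comp_self_pow (T : V →ₗ[ℝ] W) (q : ℕ) (x : V) (i : Fin (finrank ℝ V)) :
    (rightSingularBasis T).repr (((T.adjoint ∘ₗ T) ^ q) x) i =
      (T.singularValues i ^ 2) ^ q * (rightSingularBasis T).repr x i := by
  induction q with
  | zero => simp
  | succ q ih =>
    rw [pow_succ', Module.End.mul_apply, repr_adjoint_comp_self, ih]
    ring

theorem norm_sq_eq_sum_repr (T : V →ₗ[ℝ] W) (x : V) :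
    ‖x‖ ^ 2 = ∑ i, (rightSingularBasis T).repr x i ^ 2 := by
  rw [← (rightSingularBasis T).repr.norm_map x, EuclideanSpace.norm_sq_eq]
  simp

theorem norm_apply_sq_eq_sum (T : V →ₗ[ℝ] W) (x : V) :
    ‖T x‖ ^ 2 = ∑ i : Fin (finrank ℝ V),
      T.singularValues i ^ 2 * (rightSingularBasis T).repr x i ^ 2 := by
  have h : ‖T x‖ ^ 2 = inner ℝ ((T.adjoint ∘ₗ T) x) x := by
    rw [LinearMap.comp_apply, LinearMap.adjoint_inner_left, real_inner_self_eq_norm_sq]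
  rw [h, ← (rightSingularBasis T).repr.inner_map_map, PiLp.inner_apply]
  refine Finset.sum_congr rfl fun i _ => ?_
  rw [repr_adjoint_comp_self]
  simp only [RCLike.inner_apply, conj_trivial]
  ring

theorem norm_apply_le_singularValues_zero (T : V →ₗ[ℝ] W) (x : V) :
    ‖T x‖ ≤ T.singularValues 0 * ‖x‖ := by
  refine le_of_sq_le_sq ?_ (by have := T.singularValues_nonneg 0; positivity)
  rw [mul_pow, norm_apply_sq_eq_sum, norm_sq_eq_sum_repr T x, Finset.mul_sum]
  gcongr with i
  · exact T.singularValues_nonneg _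
  · exact T.singularValues_antitone (Nat.zero_le _)

theorem singularValues_last_mul_norm_le (T : V →ₗ[ℝ] W) (x : V) :
    T.singularValues (finrank ℝ V - 1) * ‖x‖ ≤ ‖T x‖ := by
  refine le_of_sq_le_sq ?_ (norm_nonneg _)
  rw [mul_pow, norm_apply_sq_eq_sum, norm_sq_eq_sum_repr T x, Finset.mul_sum]
  gcongr with i
  · exact T.singularValues_nonneg _
  · exact T.singularValues_antitone (by omega)

/-- A perturbation of a map of rank at most `k` has its singular values from the `(k+1)`-st on
bounded by the size of the perturbation: some nonzero combination of the first `k + 1` right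
singular vectors is annihilated by the low-rank part. -/
theorem singularValues_le_of_add {T M N : V →ₗ[ℝ] W} {k : ℕ} {c : ℝ} (hc : 0 ≤ c)
    (hT : T = M + N) (hM : finrank ℝ M.range ≤ k) (hN : ∀ x, ‖N x‖ ≤ c * ‖x‖) :
    T.singularValues k ≤ c := by
  by_cases! hk : finrank ℝ V ≤ k
  · rw [T.singularValues_of_finrank_le hk]; exact hc
  set b := rightSingularBasis T
  let ι : Fin (k + 1) → Fin (finrank ℝ V) := Fin.castLE hk
  let S : Submodule ℝ V := Submodule.span ℝ (Set.range (b ∘ ι))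
  have hli : LinearIndependent ℝ (b ∘ ι) :=
    b.orthonormal.linearIndependent.comp ι (Fin.castLE_injective _)
  have hS : finrank ℝ S = k + 1 := by
    rw [finrank_span_eq_card hli, Fintype.card_fin]
  have hninj : ¬ Function.Injective (M.rangeRestrict ∘ₗ S.subtype) := fun h => by
    have := LinearMap.finrank_le_finrank_of_injective h
    omega
  rw [← LinearMap.ker_eq_bot, Submodule.eq_bot_iff] at hninj
  push Not at hninj
  obtain ⟨⟨x, hxS⟩, hx, hx0⟩ := hninj
  have hMx : M x = 0 := by simpa [LinearMap.mem_ker, Subtype.ext_iff] using hx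
  have hx0 : 0 < ‖x‖ := by simpa [Subtype.ext_iff] using hx0
  have hcoord : ∀ i : Fin (finrank ℝ V), k < i → b.repr x i = 0 := by
    intro i hi
    rw [b.repr_apply_apply]
    refine Submodule.span_induction (p := fun y _ => inner ℝ (b i) y = 0) ?_ (by simp) ?_ ?_ hxS
    · rintro _ ⟨j, rfl⟩
      refine b.orthonormal.2 fun h => ?_
      have := congrArg Fin.val h
      simp [ι] at this
      omega
    · intro y z _ _ hy hz
      rw [inner_add_right, hy, hz, add_zero]
    · intro a y _ hy
      rw [inner_smul_right, hy, mul_zero]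
  have hlow : T.singularValues k * ‖x‖ ≤ ‖T x‖ := by
    refine le_of_sq_le_sq ?_ (norm_nonneg _)
    rw [mul_pow, norm_apply_sq_eq_sum, norm_sq_eq_sum_repr T x, Finset.mul_sum]
    refine Finset.sum_le_sum fun i _ => ?_
    by_cases hi : (k : ℕ) < i
    · have := hcoord i hi
      simp only [b] at this
      simp [this]
    · gcongr
      · exact T.singularValues_nonneg _
      · exact T.singularValues_antitone (by omega)
  have hup : ‖T x‖ ≤ c * ‖x‖ := by
    have := hN x
    rwa [hT, LinearMap.add_apply, hMx, zero_add]
  exact le_of_mul_le_mul_right (hlow.trans hup) hx0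

/-! ### Power iteration on a subspace -/

/-- The subspace iteration estimate in coordinates. The weights `g i` are the squared singular
values, `H` is the set of the leading indices, `c` is the starting vector and `x` the target, and
`g i ^ q * c i` are the coordinates of the iterate, matched to those of `x` on `H`. The hypothesis
`hs` says that the map does not shrink `c` below the factor `s`; as its tail part contributes at
most the factor `β`, most of `T c` lies in the leading directions. -/
theorem sum_tail_sub_sq_le {ι : Type*} [Fintype ι] [DecidableEq ι] (H : Finset ι)
    {g c x : ι → ℝ} {α β s ρ : ℝ} {q : ℕ} (hq : 1 ≤ q)
    (hα : 0 < α) (hβ : 0 < β) (hρ : 0 < ρ) (hs0 : 0 < s)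
    (hg : ∀ i, 0 ≤ g i) (hH : ∀ i ∈ H, α ≤ g i) (hHc : ∀ i ∈ Hᶜ, g i ≤ β)
    (hx : ∀ i ∈ H, g i ^ q * c i = x i)
    (hs : s * ∑ i, c i ^ 2 ≤ ∑ i, g i * c i ^ 2) (hβs : β ≤ ρ * (s - β)) :
    ∑ i, g i * (x i - g i ^ q * c i) ^ 2 ≤
      β * (1 + ρ * (β / α) ^ (2 * q - 1)) * ∑ i, x i ^ 2 := by
  obtain ⟨p, rfl⟩ : ∃ p, q = p + 1 := ⟨q - 1, by omega⟩
  have hp : 2 * (p + 1) - 1 = 2 * p + 1 := by omega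
  rw [hp]
  set η := ∑ i ∈ H, g i * c i ^ 2
  set τ := ∑ i ∈ Hᶜ, g i * c i ^ 2
  have hητ : ∑ i, g i * c i ^ 2 = η + τ := (Finset.sum_add_sum_compl H _).symm
  have hη0 : 0 ≤ η := Finset.sum_nonneg fun i _ => mul_nonneg (hg i) (sq_nonneg _)
  have hτ0 : 0 ≤ τ := Finset.sum_nonneg fun i _ => mul_nonneg (hg i) (sq_nonneg _)
  have hτβ : τ ≤ β * ∑ i, c i ^ 2 := by
    calc τ ≤ ∑ i ∈ Hᶜ, β * c i ^ 2 := Finset.sum_le_sum fun i hi => by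
          gcongr; exact hHc i hi
      _ = β * ∑ i ∈ Hᶜ, c i ^ 2 := by rw [Finset.mul_sum]
      _ ≤ β * ∑ i, c i ^ 2 := by
          gcongr
          exact Finset.subset_univ _
  have hτη : τ ≤ ρ * η := by
    have h1 : s * τ ≤ β * (η + τ) := by
      calc s * τ ≤ s * (β * ∑ i, c i ^ 2) := by gcongr
        _ = β * (s * ∑ i, c i ^ 2) := by ring
        _ ≤ β * (η + τ) := by rw [← hητ]; gcongr
    have hsβ : 0 < s - β := by
      by_contra! h
      have : ρ * (s - β) ≤ 0 := mul_nonpos_of_nonneg_of_nonpos hρ.le h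
      linarith
    have h2 : (s - β) * τ ≤ (s - β) * (ρ * η) := by
      have := mul_le_mul_of_nonneg_right hβs hη0
      linarith
    exact le_of_mul_le_mul_left h2 hsβ
  have hhead : α ^ (2 * p + 1) * η ≤ ∑ i ∈ H, x i ^ 2 := by
    rw [Finset.mul_sum]
    refine Finset.sum_le_sum fun i hi => ?_
    rw [← hx i hi]
    have h1 : α ^ (2 * p + 1) ≤ g i ^ (2 * p + 1) := by
      gcongr; exact hH i hi
    calc α ^ (2 * p + 1) * (g i * c i ^ 2) ≤ g i ^ (2 * p + 1) * (g i * c i ^ 2) :=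
          mul_le_mul_of_nonneg_right h1 (mul_nonneg (hg i) (sq_nonneg _))
      _ = (g i ^ (p + 1) * c i) ^ 2 := by ring
  have htail : ∑ i ∈ Hᶜ, g i * (g i ^ (p + 1) * c i) ^ 2 ≤
      β * (ρ * (β / α) ^ (2 * p + 1)) * ∑ i ∈ H, x i ^ 2 := by
    calc ∑ i ∈ Hᶜ, g i * (g i ^ (p + 1) * c i) ^ 2
        ≤ ∑ i ∈ Hᶜ, β ^ (2 * p + 2) * (g i * c i ^ 2) := Finset.sum_le_sum fun i hi => by
          have h1 : g i ^ (2 * p + 2) ≤ β ^ (2 * p + 2) := by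
            gcongr
            · exact hg i
            · exact hHc i hi
          calc g i * (g i ^ (p + 1) * c i) ^ 2 = g i ^ (2 * p + 2) * (g i * c i ^ 2) := by ring
            _ ≤ _ := mul_le_mul_of_nonneg_right h1 (mul_nonneg (hg i) (sq_nonneg _))
      _ = β ^ (2 * p + 2) * τ := by rw [Finset.mul_sum]
      _ ≤ β ^ (2 * p + 2) * (ρ * η) := by gcongr
      _ = β * (ρ * (β / α) ^ (2 * p + 1)) * (α ^ (2 * p + 1) * η) := by
          rw [div_pow]; field_simp; ring
      _ ≤ _ := by gcongr
  set t := ρ * (β / α) ^ (2 * p + 1)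
  have ht : 0 < t := by positivity
  have hxt : ∑ i ∈ Hᶜ, g i * x i ^ 2 ≤ β * ∑ i ∈ Hᶜ, x i ^ 2 := by
    rw [Finset.mul_sum]
    exact Finset.sum_le_sum fun i hi => mul_le_mul_of_nonneg_right (hHc i hi) (sq_nonneg _)
  -- Young's inequality with the weight `t` makes the two parts of `x` contribute equally.
  have hyoung : ∀ u v : ℝ, (u - v) ^ 2 ≤ (1 + t) * u ^ 2 + (1 + 1 / t) * v ^ 2 := fun u v => by
    have h : (1 + t) * u ^ 2 + (1 + 1 / t) * v ^ 2 - (u - v) ^ 2 = (t * u + v) ^ 2 / t := by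
      field_simp; ring
    have : 0 ≤ (t * u + v) ^ 2 / t := by positivity
    linarith
  rw [← Finset.sum_add_sum_compl H]
  have h0 : ∑ i ∈ H, g i * (x i - g i ^ (p + 1) * c i) ^ 2 = 0 :=
    Finset.sum_eq_zero fun i hi => by rw [hx i hi]; ring
  rw [h0, zero_add]
  calc ∑ i ∈ Hᶜ, g i * (x i - g i ^ (p + 1) * c i) ^ 2
      ≤ ∑ i ∈ Hᶜ, ((1 + t) * (g i * x i ^ 2) +
          (1 + 1 / t) * (g i * (g i ^ (p + 1) * c i) ^ 2)) :=
        Finset.sum_le_sum fun i _ => by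
          have := mul_le_mul_of_nonneg_left (hyoung (x i) (g i ^ (p + 1) * c i)) (hg i)
          linarith
    _ = (1 + t) * ∑ i ∈ Hᶜ, g i * x i ^ 2 +
          (1 + 1 / t) * ∑ i ∈ Hᶜ, g i * (g i ^ (p + 1) * c i) ^ 2 := by
        rw [Finset.sum_add_distrib, Finset.mul_sum, Finset.mul_sum]
    _ ≤ (1 + t) * (β * ∑ i ∈ Hᶜ, x i ^ 2) + (1 + 1 / t) * (β * t * ∑ i ∈ H, x i ^ 2) := by
        gcongr
    _ = β * (1 + t) * ∑ i, x i ^ 2 := by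
        rw [← Finset.sum_add_sum_compl H]; field_simp; ring

/-- Subspace iteration. If `T` is bounded below by `s` on a `k`-dimensional subspace `C`, with `s`
well above the `(k+1)`-st singular value, then the image of `C` under `T (T* T) ^ q` approximates
the range of `T` almost as well as the span of the leading `k` left singular vectors does. -/
theorem exists_mem_norm_sub_iterate_sq_le (T : V →ₗ[ℝ] W) (C : Submodule ℝ V) {k q : ℕ}
    (hk : 1 ≤ k) (hq : 1 ≤ q) (hC : finrank ℝ C = k) {s ρ : ℝ} (hs0 : 0 < s) (hρ : 0 < ρ)
    (hs : ∀ c ∈ C, s * ‖c‖ ≤ ‖T c‖) (hpos : 0 < T.singularValues k)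
    (hsρ : T.singularValues k ^ 2 ≤ ρ * (s ^ 2 - T.singularValues k ^ 2)) (x : V) :
    ∃ c ∈ C, ‖T x - T (((T.adjoint ∘ₗ T) ^ q) c)‖ ^ 2 ≤
      T.singularValues k ^ 2 *
        (1 + ρ * (T.singularValues k ^ 2 / T.singularValues (k - 1) ^ 2) ^ (2 * q - 1)) *
        ‖x‖ ^ 2 := by
  set b := rightSingularBasis T
  have hkn : k < finrank ℝ V := by
    by_contra! h
    rw [T.singularValues_of_finrank_le h] at hpos
    exact hpos.false
  have hpos' : 0 < T.singularValues (k - 1) :=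
    hpos.trans_le (T.singularValues_antitone (by omega))
  have hk_lt : T.singularValues k ^ 2 < s ^ 2 := by
    by_contra! h
    have h1 : ρ * (s ^ 2 - T.singularValues k ^ 2) ≤ 0 :=
      mul_nonpos_of_nonneg_of_nonpos hρ.le (by linarith)
    have h2 : 0 < T.singularValues k ^ 2 := by positivity
    linarith
  let ι : Fin k → Fin (finrank ℝ V) := Fin.castLE hkn.le
  let H : Finset (Fin (finrank ℝ V)) := Finset.univ.filter fun i => (i : ℕ) < k
  have hs' : ∀ c ∈ C, s ^ 2 * ∑ i, b.repr c i ^ 2 ≤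
      ∑ i : Fin (finrank ℝ V), T.singularValues i ^ 2 * b.repr c i ^ 2 := fun c hc => by
    rw [← norm_sq_eq_sum_repr, ← norm_apply_sq_eq_sum, ← mul_pow]
    have := hs c hc
    gcongr
  let L : C →ₗ[ℝ] (Fin k → ℝ) := LinearMap.pi fun i =>
    innerₛₗ ℝ (b (ι i)) ∘ₗ ((T.adjoint ∘ₗ T) ^ q) ∘ₗ C.subtype
  have hL : ∀ (c : C) (i : Fin k),
      L c i = (T.singularValues (ι i) ^ 2) ^ q * b.repr c (ι i) := fun c i => by
    rw [← repr_adjoint_comp_self_pow, OrthonormalBasis.repr_apply_apply]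
    rfl
  have hinj : Function.Injective L := by
    rw [← LinearMap.ker_eq_bot, Submodule.eq_bot_iff]
    rintro ⟨c, hc⟩ hLc
    rw [LinearMap.mem_ker] at hLc
    have hhead : ∀ i : Fin (finrank ℝ V), (i : ℕ) < k → b.repr c i = 0 := fun i hi => by
      have h1 := hL ⟨c, hc⟩ ⟨i, hi⟩
      have h2 : 0 < T.singularValues i :=
        hpos.trans_le (T.singularValues_antitone hi.le)
      have h3 : ι ⟨i, hi⟩ = i := Fin.ext rfl
      rw [hLc, h3] at h1
      have h4 : (T.singularValues i ^ 2) ^ q ≠ 0 := by positivity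
      simpa [h4] using h1.symm
    have h1 : ∑ i : Fin (finrank ℝ V), T.singularValues i ^ 2 * b.repr c i ^ 2 ≤
        T.singularValues k ^ 2 * ∑ i, b.repr c i ^ 2 := by
      rw [Finset.mul_sum]
      refine Finset.sum_le_sum fun i _ => ?_
      by_cases hi : (i : ℕ) < k
      · simp [hhead i hi]
      · gcongr
        · exact T.singularValues_nonneg _
        · exact T.singularValues_antitone (by omega)
    have h2 := (hs' c hc).trans h1
    rw [← norm_sq_eq_sum_repr] at h2
    have h3 : ‖c‖ ^ 2 = 0 := by
      by_contra h
      have : 0 < ‖c‖ ^ 2 := lt_of_le_of_ne (sq_nonneg _) (Ne.symm h)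
      exact hk_lt.not_ge (le_of_mul_le_mul_right h2 this)
    exact Subtype.ext (by simpa using h3)
  have hsurj : Function.Surjective L :=
    (LinearMap.injective_iff_surjective_of_finrank_eq_finrank (by simp [hC])).1 hinj
  obtain ⟨⟨c, hc⟩, hLc⟩ := hsurj fun i => b.repr x (ι i)
  refine ⟨c, hc, ?_⟩
  rw [← map_sub, norm_apply_sq_eq_sum, norm_sq_eq_sum_repr T x]
  have key := sum_tail_sub_sq_le H
    (g := fun i : Fin (finrank ℝ V) => T.singularValues i ^ 2) (c := fun i => b.repr c i)
    (x := fun i => b.repr x i) (α := T.singularValues (k - 1) ^ 2)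
    (β := T.singularValues k ^ 2) (s := s ^ 2) (ρ := ρ) (q := q) hq (by positivity)
    (by positivity) hρ (by positivity) (fun i => sq_nonneg _) ?_ ?_ ?_ (hs' c hc) hsρ
  · refine le_of_eq_of_le (Finset.sum_congr rfl fun i _ => ?_) key
    rw [map_sub, PiLp.sub_apply, repr_adjoint_comp_self_pow]
  · intro i hi
    have hi : (i : ℕ) < k := by simpa [H] using hi
    gcongr
    exact T.singularValues_antitone (by omega)
  · intro i hi
    have hi : k ≤ (i : ℕ) := by simpa [H] using hi
    gcongr
    · exact T.singularValues_nonneg _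
    · exact T.singularValues_antitone hi
  · intro i hi
    have hi : (i : ℕ) < k := by simpa [H] using hi
    exact (hL ⟨c, hc⟩ ⟨i, hi⟩).symm.trans (congrFun hLc ⟨i, hi⟩)

end Spectral


/-! ### Selecting a column in the successive projection algorithm -/

section Selection

variable {W : Type*} [NormedAddCommGroup W] [InnerProductSpace ℝ W]
  {ι : Type*} [Fintype ι]

theorem norm_sum_smul_sq_le (C : Finset ι) (u : ι → W) (y : ι → ℝ) {δ : ℝ}
    (hu : ∀ i ∈ C, ‖u i‖ ≤ δ) :
    ‖∑ i ∈ C, y i • u i‖ ^ 2 ≤ Fintype.card ι * δ ^ 2 * ∑ i ∈ C, y i ^ 2 := by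
  have h1 : ‖∑ i ∈ C, y i • u i‖ ≤ ∑ i ∈ C, |y i| * δ := by
    refine (norm_sum_le _ _).trans (Finset.sum_le_sum fun i hi => ?_)
    rw [norm_smul, Real.norm_eq_abs]
    exact mul_le_mul_of_nonneg_left (hu i hi) (abs_nonneg _)
  calc ‖∑ i ∈ C, y i • u i‖ ^ 2 ≤ (∑ i ∈ C, |y i| * δ) ^ 2 := by gcongr
    _ ≤ C.card * ∑ i ∈ C, (|y i| * δ) ^ 2 := sq_sum_le_card_mul_sum_sq
    _ = C.card * (δ ^ 2 * ∑ i ∈ C, y i ^ 2) := by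
        congr 1
        rw [Finset.mul_sum]
        refine Finset.sum_congr rfl fun i _ => ?_
        rw [mul_pow, sq_abs, mul_comm]
    _ ≤ Fintype.card ι * (δ ^ 2 * ∑ i ∈ C, y i ^ 2) := by
        gcongr
        exact Finset.card_le_univ C
    _ = _ := by ring

variable [DecidableEq ι]

/-- Projecting away vectors `b i`, `i ∈ C`, that are close to the `f i` leaves the remaining `f i`
well conditioned. The bound is that of the distance from a vector to the span of the `b i`. -/
theorem deflated_lower_bound (f b : ι → W) (C : Finset ι) (P : W →ₗ[ℝ] W) {σ δ : ℝ}
    (hf : ∀ x : ι → ℝ, σ ^ 2 * ∑ i, x i ^ 2 ≤ ‖∑ i, x i • f i‖ ^ 2)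
    (hb : ∀ i ∈ C, ‖b i - f i‖ ≤ δ) (hδ : Fintype.card ι * δ ^ 2 ≤ σ ^ 2 / 4)
    (hP : ∀ v, v - P v ∈ Submodule.span ℝ (b '' C))
    (x : ι → ℝ) (hx : ∀ i ∈ C, x i = 0) :
    3 / 4 * σ ^ 2 * ∑ i, x i ^ 2 ≤ ‖∑ i, x i • P (f i)‖ ^ 2 := by
  have hPx := hP (∑ i, x i • f i)
  rw [Submodule.mem_span_image_finset_iff_exists_fun] at hPx
  obtain ⟨y', hy'⟩ := hPx
  simp only [map_sum, map_smul] at hy'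
  let y : ι → ℝ := fun i => if hi : i ∈ C then y' ⟨i, hi⟩ else 0
  have hy : ∑ i ∈ C, y i • b i = ∑ i, x i • f i - ∑ i, x i • P (f i) := by
    rw [← hy', ← Finset.sum_coe_sort]
    exact Finset.sum_congr rfl fun i _ => by simp [y]
  set X := ∑ i, x i ^ 2
  set Y := ∑ i ∈ C, y i ^ 2
  -- `P (∑ x i • f i)` is `∑ z i • f i` up to a combination of the errors `b i - f i`.
  let z : ι → ℝ := fun i => if i ∈ C then -y i else x i
  have hz : ∑ i, z i • f i = ∑ i, x i • f i - ∑ i ∈ C, y i • f i := by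
    rw [← Finset.sum_add_sum_compl C (fun i => z i • f i),
      ← Finset.sum_add_sum_compl C (fun i => x i • f i),
      Finset.sum_congr rfl (g := fun i => -(y i • f i)) (fun i hi => by simp [z, hi]),
      Finset.sum_congr (s₁ := Cᶜ) rfl (g := fun i => x i • f i)
        (fun i hi => by simp [z, Finset.mem_compl.1 hi]),
      Finset.sum_eq_zero (s := C) (f := fun i => x i • f i) (fun i hi => by simp [hx i hi]),
      Finset.sum_neg_distrib]
    abel
  have hz2 : ∑ i, z i ^ 2 = X + Y := by
    rw [← Finset.sum_add_sum_compl C (fun i => z i ^ 2),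
      show X = ∑ i ∈ C, x i ^ 2 + ∑ i ∈ Cᶜ, x i ^ 2 from (Finset.sum_add_sum_compl C _).symm,
      Finset.sum_congr rfl (g := fun i => y i ^ 2) (fun i hi => by simp [z, hi]),
      Finset.sum_congr (s₁ := Cᶜ) rfl (g := fun i => x i ^ 2)
        (fun i hi => by simp [z, Finset.mem_compl.1 hi]),
      Finset.sum_eq_zero (s := C) (f := fun i => x i ^ 2) (fun i hi => by simp [hx i hi])]
    ring
  have hPe : ∑ i, x i • P (f i) = ∑ i, z i • f i - ∑ i ∈ C, y i • (b i - f i) := by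
    simp only [smul_sub, Finset.sum_sub_distrib]
    rw [hz, hy]
    abel
  set p := ‖∑ i, z i • f i‖
  set e := ‖∑ i ∈ C, y i • (b i - f i)‖
  have hp : σ ^ 2 * (X + Y) ≤ p ^ 2 := hz2 ▸ hf z
  have hY : 0 ≤ Y := Finset.sum_nonneg fun i _ => sq_nonneg _
  have hX : 0 ≤ X := Finset.sum_nonneg fun i _ => sq_nonneg _
  have he : e ^ 2 ≤ σ ^ 2 / 4 * Y :=
    (norm_sum_smul_sq_le C _ y hb).trans (mul_le_mul_of_nonneg_right hδ hY)
  have hσX : 0 ≤ σ ^ 2 * X := by positivity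
  have hep : e ≤ p := by
    refine le_of_sq_le_sq ?_ (norm_nonneg _)
    nlinarith [sq_nonneg e]
  have hge : p - e ≤ ‖∑ i, x i • P (f i)‖ := by
    rw [hPe]; exact norm_sub_norm_le _ _
  calc 3 / 4 * σ ^ 2 * X ≤ (p - e) ^ 2 := by nlinarith [sq_nonneg (p / 2 - 2 * e)]
    _ ≤ _ := by
        have : 0 ≤ p - e := sub_nonneg.2 hep
        gcongr

/-- A subconvex combination `y` of the `v i` that is almost as long as the longest of them must put
almost all its weight on a single `v i`. The index is the one maximizing `⟪v i, y⟫`: any other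
`v l` has an inner product with `y` that falls short of `K ‖y‖` by a fixed amount, since the
midpoint of two separated vectors of norm at most `K` lies well inside the ball. The error in the
weight is linear in `ε`. -/
theorem exists_dominant_weight (v : ι → W) (U : Finset ι) (h : ι → ℝ) {σ δ ε K : ℝ}
    (hσ : 0 < σ) (hK : 0 < K) (h0 : ∀ i, 0 ≤ h i) (h1 : ∑ i, h i ≤ 1)
    (hU : ∀ i ∈ U, ‖v i‖ ≤ K) (hC : ∀ i ∉ U, ‖v i‖ ≤ δ) (hδ : δ ≤ σ / 4) (hε : ε ≤ σ / 8)
    (hKσ : 3 / 4 * σ ^ 2 ≤ K ^ 2)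
    (hsep : ∀ i ∈ U, ∀ l ∈ U, i ≠ l → 3 / 2 * σ ^ 2 ≤ ‖v i - v l‖ ^ 2)
    (hy : K - 2 * ε ≤ ‖∑ i, h i • v i‖) :
    ∃ i ∈ U, (1 - h i) * (3 * σ ^ 2) ≤ 32 * K * ε := by
  have hK45 : 4 / 5 * σ ≤ K := by
    refine le_of_sq_le_sq ?_ hK.le
    nlinarith [sq_nonneg σ]
  set y := ∑ i, h i • v i with hydef
  have hYpos : δ < ‖y‖ := by linarith
  have hY0 : 0 < ‖y‖ := by linarith
  have hYsum : ‖y‖ ^ 2 = ∑ i, h i * inner ℝ (v i) y := by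
    rw [← real_inner_self_eq_norm_sq]
    nth_rewrite 1 [hydef]
    rw [sum_inner]
    simp only [real_inner_smul_left]
  have hne : (Finset.univ : Finset ι).Nonempty := by
    by_contra hc
    rw [Finset.not_nonempty_iff_eq_empty] at hc
    have : y = 0 := by rw [hydef, hc, Finset.sum_empty]
    rw [this, norm_zero] at hY0
    exact hY0.false
  obtain ⟨j, -, hj⟩ := Finset.exists_max_image Finset.univ (fun i => inner ℝ (v i) y) hne
  have hjY : ‖y‖ ^ 2 ≤ inner ℝ (v j) y := by
    have hle : ‖y‖ ^ 2 ≤ (∑ i, h i) * inner ℝ (v j) y := by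
      rw [hYsum, Finset.sum_mul]
      exact Finset.sum_le_sum fun i hi => mul_le_mul_of_nonneg_left (hj i hi) (h0 i)
    have hsum : 0 ≤ ∑ i, h i := Finset.sum_nonneg fun i _ => h0 i
    have hpos : 0 < inner ℝ (v j) y := by
      by_contra! hc
      have := mul_nonpos_of_nonneg_of_nonpos hsum hc
      have : 0 < ‖y‖ ^ 2 := by positivity
      linarith
    nlinarith
  have hjU : j ∈ U := by
    by_contra hc
    have h2 := (real_inner_le_norm (v j) y).trans
      (mul_le_mul_of_nonneg_right (hC j hc) (norm_nonneg y))
    nlinarith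
  -- `γ` solves `(2 K) ^ 2 - 3 / 2 * σ ^ 2 = (2 * (K - γ)) ^ 2` to first order: half the loss in
  -- length of `v l + v j` compared with `2 K`.
  set γ := 3 * σ ^ 2 / (16 * K) with hγ
  have hγK : γ * K = 3 / 16 * σ ^ 2 := by rw [hγ]; field_simp
  have hγ0 : 0 < γ := by positivity
  have hγle : δ ≤ K - γ := by
    have : K * δ ≤ K * (K - γ) := by nlinarith
    exact le_of_mul_le_mul_left this hK
  have hγle' : γ ≤ K := by
    refine le_of_mul_le_mul_right ?_ hK
    nlinarith [sq_nonneg σ]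
  have hother : ∀ l, l ≠ j → inner ℝ (v l) y ≤ (K - γ) * ‖y‖ := by
    intro l hl
    by_cases hlU : l ∈ U
    · have hpar := parallelogram_law_with_norm ℝ (v l) (v j)
      have hs := hsep l hlU j hjU hl
      have hl2 := hU l hlU
      have hj2 := hU j hjU
      have hsum : ‖v l + v j‖ ≤ 2 * (K - γ) := by
        refine le_of_sq_le_sq ?_ (by linarith)
        nlinarith [norm_nonneg (v l), norm_nonneg (v j), sq_nonneg γ]
      have h3 := real_inner_le_norm (v l + v j) y
      rw [inner_add_left] at h3
      have h4 := hj l (Finset.mem_univ _)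
      have h5 := mul_le_mul_of_nonneg_right hsum (norm_nonneg y)
      linarith
    · exact (real_inner_le_norm _ _).trans
        (mul_le_mul_of_nonneg_right ((hC l hlU).trans hγle) (norm_nonneg y))
  have hjK : inner ℝ (v j) y ≤ K * ‖y‖ :=
    (real_inner_le_norm _ _).trans (mul_le_mul_of_nonneg_right (hU j hjU) (norm_nonneg y))
  have hrest : ∑ i ∈ Finset.univ.erase j, h i ≤ 1 - h j := by
    have := Finset.sum_erase_add Finset.univ h (Finset.mem_univ j)
    linarith
  have hfin : ‖y‖ * ‖y‖ ≤ (K - (1 - h j) * γ) * ‖y‖ := by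
    calc ‖y‖ * ‖y‖ = ∑ i ∈ Finset.univ.erase j, h i * inner ℝ (v i) y
          + h j * inner ℝ (v j) y := by
          rw [← sq, hYsum, Finset.sum_erase_add _ _ (Finset.mem_univ j)]
      _ ≤ ∑ i ∈ Finset.univ.erase j, h i * ((K - γ) * ‖y‖) + h j * (K * ‖y‖) := by
          refine add_le_add (Finset.sum_le_sum fun i hi => ?_)
            (mul_le_mul_of_nonneg_left hjK (h0 j))
          exact mul_le_mul_of_nonneg_left (hother i (Finset.ne_of_mem_erase hi)) (h0 i)
      _ = (∑ i ∈ Finset.univ.erase j, h i) * ((K - γ) * ‖y‖) + h j * (K * ‖y‖) := by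
          rw [Finset.sum_mul]
      _ ≤ (1 - h j) * ((K - γ) * ‖y‖) + h j * (K * ‖y‖) := by
          have : 0 ≤ (K - γ) * ‖y‖ := mul_nonneg (by linarith) (norm_nonneg y)
          gcongr
      _ = _ := by ring
  have hfin2 := le_of_mul_le_mul_right hfin hY0
  refine ⟨j, hjU, ?_⟩
  have h6 : (1 - h j) * γ ≤ 2 * ε := by linarith
  have h7 := mul_le_mul_of_nonneg_right h6 hK.le
  have h8 : (1 - h j) * γ * K = (1 - h j) * (3 / 16 * σ ^ 2) := by rw [mul_assoc, hγK]
  linarith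

/-- One selection of the algorithm. After the vectors `b i ≈ f i`, `i ∈ C`, have been projected
away, a vector `a = ∑ h i • f i + n` whose projection is, up to the noise, at least as long as those
of all `f i`, is close to a not yet represented `f i`. The error `δ` does not depend on the errors
made before, so that it does not accumulate over the selections. -/
theorem exists_near_of_maximal_projection (f b : ι → W) (C : Finset ι) (hCne : C ≠ Finset.univ)
    (P : W →ₗ[ℝ] W) {σ δ ε K : ℝ} (hσ : 0 < σ) (hε : 0 ≤ ε)
    (hδ : δ = ε * (1 + 64 / 3 * (K / σ) ^ 2))
    (hδσ : Fintype.card ι * δ ^ 2 ≤ σ ^ 2 / 16)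
    (hf : ∀ x : ι → ℝ, σ ^ 2 * ∑ i, x i ^ 2 ≤ ‖∑ i, x i • f i‖ ^ 2)
    (hfK : ∀ i, ‖f i‖ ≤ K) (hb : ∀ i ∈ C, ‖b i - f i‖ ≤ δ)
    (hPle : ∀ v, ‖P v‖ ≤ ‖v‖) (hPb : ∀ i ∈ C, P (b i) = 0)
    (hPspan : ∀ v, v - P v ∈ Submodule.span ℝ (b '' C))
    (h : ι → ℝ) (h0 : ∀ i, 0 ≤ h i) (h1 : ∑ i, h i ≤ 1) (n : W) (hn : ‖n‖ ≤ ε)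
    (hmax : ∀ i, ‖P (f i)‖ - ε ≤ ‖P (∑ i, h i • f i + n)‖) :
    P (∑ i, h i • f i + n) ≠ 0 ∧ ∃ i ∉ C, ‖∑ i, h i • f i + n - f i‖ ≤ δ := by
  obtain ⟨i₀, hi₀⟩ : ∃ i, i ∉ C := by
    by_contra! hc
    exact hCne (Finset.eq_univ_of_forall hc)
  have hlow := deflated_lower_bound f b C P hf hb
    (hδσ.trans (by nlinarith [sq_nonneg σ])) hPspan
  have hlow1 : ∀ i ∉ C, 3 / 4 * σ ^ 2 ≤ ‖P (f i)‖ ^ 2 := fun i hi => by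
    have := hlow (Pi.single i 1) (fun l hl => by
      rw [Pi.single_eq_of_ne]; rintro rfl; exact hi hl)
    simpa [Pi.single_apply, ite_pow, ite_smul] using this
  have hsep : ∀ i ∈ Cᶜ, ∀ l ∈ Cᶜ, i ≠ l → 3 / 2 * σ ^ 2 ≤ ‖P (f i) - P (f l)‖ ^ 2 := by
    intro i hi l hl hil
    rw [Finset.mem_compl] at hi hl
    have := hlow (Pi.single i 1 - Pi.single l 1) (fun t ht => by
      rw [Pi.sub_apply, Pi.single_eq_of_ne, Pi.single_eq_of_ne, sub_zero]
      · rintro rfl; exact hl ht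
      · rintro rfl; exact hi ht)
    have hsq : ∑ t, (Pi.single i (1 : ℝ) - Pi.single l 1 : ι → ℝ) t ^ 2 = 2 := by
      have : ∀ t, (Pi.single i (1 : ℝ) - Pi.single l 1 : ι → ℝ) t ^ 2 =
          (if t = i then 1 else 0) + (if t = l then 1 else 0) := fun t => by
        simp only [Pi.sub_apply, Pi.single_apply]
        split_ifs with ha hb
        · exact absurd (ha.symm.trans hb) hil
        all_goals norm_num
      rw [Finset.sum_congr rfl fun t _ => this t, Finset.sum_add_distrib]
      simp
      norm_num
    rw [hsq] at this
    simp only [Pi.sub_apply, sub_smul, Finset.sum_sub_distrib, Pi.single_apply, ite_smul,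
      one_smul, zero_smul, Finset.sum_ite_eq', Finset.mem_univ, if_true] at this
    linarith
  obtain ⟨i₁, hi₁, hi₁max⟩ := Finset.exists_max_image Cᶜ (fun i => ‖P (f i)‖)
    ⟨i₀, Finset.mem_compl.2 hi₀⟩
  set K' := ‖P (f i₁)‖
  have hK'σ : 3 / 4 * σ ^ 2 ≤ K' ^ 2 := hlow1 i₁ (Finset.mem_compl.1 hi₁)
  have hK'K : K' ≤ K := (hPle _).trans (hfK _)
  have hK' : 4 / 5 * σ ≤ K' := by
    refine le_of_sq_le_sq ?_ (norm_nonneg _)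
    nlinarith [sq_nonneg σ]
  have hK'0 : 0 < K' := by linarith
  have hK0 : 0 < K := by linarith
  have hκ : (4 / 5 : ℝ) ≤ K / σ := by rw [le_div_iff₀ hσ]; linarith
  have hεδ : 2 * ε ≤ δ := by
    have : (4 / 5 : ℝ) ^ 2 ≤ (K / σ) ^ 2 := by gcongr
    rw [hδ]
    nlinarith
  have hδ0 : 0 ≤ δ := by linarith
  have hδ4 : δ ≤ σ / 4 := by
    refine le_of_sq_le_sq ?_ (by linarith)
    have h2 : (1 : ℝ) ≤ Fintype.card ι := by
      exact_mod_cast Fintype.card_pos_iff.2 ⟨i₀⟩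
    nlinarith [sq_nonneg δ]
  have hPn : ‖P n‖ ≤ ε := (hPle n).trans hn
  have hPa : P (∑ i, h i • f i + n) = ∑ i, h i • P (f i) + P n := by
    simp only [map_add, map_sum, map_smul]
  have hmax1 := hmax i₁
  have hPC : ∀ i ∉ Cᶜ, ‖P (f i)‖ ≤ δ := fun i hi => by
    have hi : i ∈ C := by simpa using hi
    have h2 : P (f i) = -P (b i - f i) := by rw [map_sub, hPb i hi]; simp
    rw [h2, norm_neg]
    exact (hPle _).trans (hb i hi)
  constructor
  · intro hc
    rw [hc, norm_zero] at hmax1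
    change K' - ε ≤ 0 at hmax1
    linarith
  · have hlen : K' - 2 * ε ≤ ‖∑ i, h i • P (f i)‖ := by
      have := norm_add_le (∑ i, h i • P (f i)) (P n)
      rw [hPa] at hmax1
      change K' - ε ≤ _ at hmax1
      linarith
    obtain ⟨i, hi, hiw⟩ := exists_dominant_weight (fun i => P (f i)) Cᶜ h hσ hK'0 h0 h1
      hi₁max hPC hδ4 (by linarith) hK'σ hsep hlen
    refine ⟨i, Finset.mem_compl.1 hi, ?_⟩
    have hrest : ∑ l ∈ Finset.univ.erase i, h l ≤ 1 - h i := by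
      have := Finset.sum_erase_add Finset.univ h (Finset.mem_univ i)
      linarith
    have hdecomp : ∑ l, h l • f l + n - f i =
        ∑ l ∈ Finset.univ.erase i, h l • f l - (1 - h i) • f i + n := by
      rw [← Finset.sum_erase_add Finset.univ (fun l => h l • f l) (Finset.mem_univ i),
        sub_smul, one_smul]
      abel
    have hhi : 0 ≤ 1 - h i :=
      (Finset.sum_nonneg fun l _ => h0 l).trans hrest
    have hn1 : ‖∑ l ∈ Finset.univ.erase i, h l • f l‖ ≤ (1 - h i) * K := by
      calc ‖∑ l ∈ Finset.univ.erase i, h l • f l‖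
          ≤ ∑ l ∈ Finset.univ.erase i, h l * K := by
            refine (norm_sum_le _ _).trans (Finset.sum_le_sum fun l _ => ?_)
            rw [norm_smul, Real.norm_eq_abs, abs_of_nonneg (h0 l)]
            exact mul_le_mul_of_nonneg_left (hfK l) (h0 l)
        _ = (∑ l ∈ Finset.univ.erase i, h l) * K := by rw [Finset.sum_mul]
        _ ≤ _ := by gcongr
    have hn2 : ‖(1 - h i) • f i‖ ≤ (1 - h i) * K := by
      rw [norm_smul, Real.norm_eq_abs, abs_of_nonneg hhi]
      exact mul_le_mul_of_nonneg_left (hfK i) hhi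
    have hw : 2 * ((1 - h i) * K) ≤ ε * (64 / 3 * (K / σ) ^ 2) := by
      have h3 : (1 - h i) * (3 * σ ^ 2) ≤ 32 * K * ε := hiw.trans (by gcongr)
      have h4 : ε * (64 / 3 * (K / σ) ^ 2) = 2 * (32 * K * ε / (3 * σ ^ 2) * K) := by
        field_simp
        ring
      rw [h4]
      gcongr
      rwa [le_div_iff₀ (by positivity)]
    rw [hdecomp, hδ]
    have h5 := norm_add_le (∑ l ∈ Finset.univ.erase i, h l • f l - (1 - h i) • f i) n
    have h6 := norm_sub_le (∑ l ∈ Finset.univ.erase i, h l • f l) ((1 - h i) • f i)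
    linarith

end Selection

/-! ### The columns found by the successive projection algorithm -/

section Loop

variable {d m k : ℕ}

/-- The `j`-th column of a matrix as a vector of Euclidean space. -/
def colVec {d m : ℕ} (A : Matrix (Fin d) (Fin m) ℝ) (j : Fin m) : EuclideanSpace ℝ (Fin d) :=
  WithLp.toLp 2 (A.col j)

theorem normSq_eq_norm_sq (v : Fin d → ℝ) : normSq v = ‖WithLp.toLp 2 v‖ ^ 2 := by
  rw [EuclideanSpace.norm_sq_eq]
  simp [normSq]

/-- The residual is `‖v - (‖t‖²)⁻¹ ⟪t, v⟫ t‖`; for `t = 0` it is `‖v‖` as `0⁻¹ = 0`. -/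
theorem norm_sub_projection_le {W : Type*} [NormedAddCommGroup W] [InnerProductSpace ℝ W]
    (t v : W) : ‖v - ((‖t‖ ^ 2)⁻¹ * inner ℝ t v) • t‖ ≤ ‖v‖ := by
  by_cases ht : t = 0
  · simp [ht]
  have ht : 0 < ‖t‖ := norm_pos_iff.2 ht
  refine le_of_sq_le_sq ?_ (norm_nonneg _)
  rw [norm_sub_sq_real, inner_smul_right, norm_smul, real_inner_comm t v, mul_pow, Real.norm_eq_abs,
    sq_abs]
  have h1 : ‖v‖ ^ 2 - 2 * ((‖t‖ ^ 2)⁻¹ * inner ℝ t v * inner ℝ t v) +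
      ((‖t‖ ^ 2)⁻¹ * inner ℝ t v) ^ 2 * ‖t‖ ^ 2 = ‖v‖ ^ 2 - (inner ℝ t v) ^ 2 / ‖t‖ ^ 2 := by
    field_simp
    ring
  rw [h1]
  have : 0 ≤ (inner ℝ t v) ^ 2 / ‖t‖ ^ 2 := by positivity
  linarith

/-- The current matrix `S` of the algorithm is `P A` for a contraction `P` that annihilates the
selected columns of `A` and moves vectors only along their span, as the orthogonal projection onto
the complement of that span does. -/
theorem Reach.exists_deflation {A S : Matrix (Fin d) (Fin m) ℝ} {I : Finset (Fin m)}
    (hS : Reach A k S I) :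
    ∃ P : EuclideanSpace ℝ (Fin d) →ₗ[ℝ] EuclideanSpace ℝ (Fin d),
      (∀ v, ‖P v‖ ≤ ‖v‖) ∧ (∀ j ∈ I, P (colVec A j) = 0) ∧
      (∀ v, v - P v ∈ Submodule.span ℝ (colVec A '' I)) ∧
      ∀ l, colVec S l = P (colVec A l) := by
  induction hS with
  | init => exact ⟨LinearMap.id, by simp, by simp, by simp, by simp⟩
  | step S I j _ _ _ ih =>
    obtain ⟨P, hle, hzero, hspan, hcol⟩ := ih
    set t := colVec S j
    refine ⟨P - ((‖t‖ ^ 2)⁻¹ • (innerₛₗ ℝ t ∘ₗ P).smulRight t), ?_, ?_, ?_, ?_⟩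
    · intro v
      have := (norm_sub_projection_le t (P v)).trans (hle v)
      simpa [mul_smul] using this
    · intro l hl
      rw [Finset.mem_insert] at hl
      rcases hl with rfl | hl
      · have h1 : P (colVec A l) = t := (hcol l).symm
        by_cases ht : t = 0
        · simp [h1, ht]
        · have : ‖t‖ ≠ 0 := norm_ne_zero_iff.2 ht
          simp [h1, smul_smul, this]
      · simp [hzero l hl]
    · intro v
      have hsub : Submodule.span ℝ (colVec A '' I) ≤
          Submodule.span ℝ (colVec A '' (insert j I : Finset (Fin m))) :=
        Submodule.span_mono (Set.image_mono (by simp))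
      have ht : t ∈ Submodule.span ℝ (colVec A '' (insert j I : Finset (Fin m))) := by
        have h1 : t = colVec A j - (colVec A j - P (colVec A j)) := by
          rw [← hcol j]; simp [t]
        rw [h1]
        exact Submodule.sub_mem _ (Submodule.subset_span ⟨j, by simp, rfl⟩)
          (hsub (hspan _))
      have h2 : v - (P - ((‖t‖ ^ 2)⁻¹ • (innerₛₗ ℝ t ∘ₗ P).smulRight t)) v =
          (v - P v) + ((‖t‖ ^ 2)⁻¹ * inner ℝ t (P v)) • t := by
        simp [mul_smul]
        abel
      rw [h2]
      exact Submodule.add_mem _ (hsub (hspan v)) (Submodule.smul_mem _ _ ht)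
    · intro l
      have h1 : normSq (S.col j) = ‖t‖ ^ 2 := normSq_eq_norm_sq _
      have h2 : inner ℝ t (colVec S l) = S.col j ⬝ᵥ S.col l := by
        simp [t, colVec, PiLp.inner_apply, dotProduct, mul_comm]
      rw [LinearMap.sub_apply, ← hcol l]
      ext i
      simp only [LinearMap.smul_apply, LinearMap.smulRight_apply, LinearMap.comp_apply,
        ← hcol l, innerₛₗ_apply_apply, h2, h1]
      simp [colVec, t, Matrix.sub_mul, Matrix.vecMulVec_mul, Matrix.vecMulVec_apply]
      exact Or.inl (mul_comm _ _)

/-- Robustness of the successive projection algorithm: the selected columns are close to distinct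
columns of `F`. The set `C` holds the indices of the columns of `F` found so far, and `J i` is the
selected column that is close to the `i`-th column of `F`. -/
theorem Reach.exists_labels {A S : Matrix (Fin d) (Fin m) ℝ} {I : Finset (Fin m)}
    (hS : Reach A k S I) (f : Fin k → EuclideanSpace ℝ (Fin d)) {σ δ ε K : ℝ}
    (hσ : 0 < σ) (hε : 0 ≤ ε) (hδ : δ = ε * (1 + 64 / 3 * (K / σ) ^ 2))
    (hδσ : k * δ ^ 2 ≤ σ ^ 2 / 16)
    (hf : ∀ x : Fin k → ℝ, σ ^ 2 * ∑ i, x i ^ 2 ≤ ‖∑ i, x i • f i‖ ^ 2)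
    (hfK : ∀ i, ‖f i‖ ≤ K) (h : Fin m → Fin k → ℝ) (h0 : ∀ j i, 0 ≤ h j i)
    (h1 : ∀ j, ∑ i, h j i ≤ 1)
    (hA : ∀ j, ‖colVec A j - ∑ i, h j i • f i‖ ≤ ε)
    (hpure : ∀ i, ∃ j, ‖colVec A j - f i‖ ≤ ε) :
    ∃ (C : Finset (Fin k)) (J : Fin k → Fin m), I = C.image J ∧ I.card = C.card ∧
      ∀ i ∈ C, ‖colVec A (J i) - f i‖ ≤ δ := by
  induction hS with
  | init =>
    by_cases hk : k = 0
    · subst hk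
      exact ⟨∅, Fin.elim0, by simp⟩
    · obtain ⟨j, -⟩ := hpure ⟨0, Nat.pos_of_ne_zero hk⟩
      exact ⟨∅, fun _ => j, by simp⟩
  | step S I j hS hI hj ih =>
    obtain ⟨C, J, rfl, hcard, hJ⟩ := ih
    obtain ⟨P, hle, hzero, hspan, hcol⟩ := hS.exists_deflation
    have hmax : ∀ l, ‖P (colVec A l)‖ ≤ ‖P (colVec A j)‖ := fun l => by
      rw [← hcol, ← hcol]
      refine le_of_sq_le_sq ?_ (norm_nonneg _)
      have := hj l
      rwa [normSq_eq_norm_sq, normSq_eq_norm_sq] at this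
    have hCne : C ≠ Finset.univ := by
      rintro rfl
      rw [hcard] at hI
      simp at hI
    have hsplit : ∑ i, h j i • f i + (colVec A j - ∑ i, h j i • f i) = colVec A j := by abel
    have key := exists_near_of_maximal_projection f (fun i => colVec A (J i)) C hCne P hσ hε hδ
      (by simpa using hδσ) hf hfK hJ hle
      (fun i hi => hzero _ (Finset.mem_image_of_mem J hi))
      (fun v => by
        have := hspan v
        rwa [Finset.coe_image, Set.image_image] at this)
      (h j) (h0 j) (h1 j) _ (hA j) (fun i => by
        obtain ⟨l, hl⟩ := hpure i
        rw [hsplit]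
        have h2 : P (f i) = P (colVec A l) - P (colVec A l - f i) := by
          rw [map_sub]; abel
        have h3 := norm_sub_le (P (colVec A l)) (P (colVec A l - f i))
        rw [← h2] at h3
        have := hmax l
        have := (hle (colVec A l - f i)).trans hl
        linarith)
    rw [hsplit] at key
    obtain ⟨hne, i, hiC, hi⟩ := key
    have hjI : j ∉ C.image J := fun hc => hne (hzero j hc)
    have hupd : ∀ l ∈ C, Function.update J i j l = J l := fun l hl => by
      rw [Function.update_of_ne]
      rintro rfl
      exact hiC hl
    refine ⟨insert i C, Function.update J i j, ?_, ?_, ?_⟩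
    · rw [Finset.image_insert, Function.update_self]
      congr 1
      exact Finset.image_congr fun l hl => (hupd l hl).symm
    · rw [Finset.card_insert_of_notMem hjI, Finset.card_insert_of_notMem hiC, hcard]
    · intro l hl
      rcases Finset.mem_insert.1 hl with rfl | hl
      · rwa [Function.update_self]
      · rw [hupd l hl]
        exact hJ l hl

end Loop


/-! ### Matrices as maps of Euclidean spaces -/

section Bridge

open Module

variable {d m k : ℕ}

theorem toEuclideanLin_eq_sum_colVec (A : Matrix (Fin d) (Fin m) ℝ)
    (x : EuclideanSpace ℝ (Fin m)) :
    Matrix.toEuclideanLin A x = ∑ j, x j • colVec A j := by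
  ext i
  simp [Matrix.toLpLin_apply, Matrix.mulVec_eq_sum, colVec, mul_comm]

theorem finrank_range_toEuclideanLin (A : Matrix (Fin d) (Fin m) ℝ) :
    finrank ℝ (Matrix.toEuclideanLin A).range = A.rank := by
  change finrank ℝ (Matrix.toLpLin 2 2 A).range = A.rank
  rw [Matrix.toLpLin_eq_toLin, ← Matrix.rank_eq_finrank_range_toLin]

theorem colVec_eq_toEuclideanLin_single (A : Matrix (Fin d) (Fin m) ℝ) (j : Fin m) :
    colVec A j = Matrix.toEuclideanLin A (EuclideanSpace.single j 1) := by
  ext i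
  simp [Matrix.toLpLin_apply, colVec]

theorem norm_toEuclideanLin_le (A : Matrix (Fin d) (Fin m) ℝ) (x : EuclideanSpace ℝ (Fin m)) :
    ‖Matrix.toEuclideanLin A x‖ ≤ ‖A‖ * ‖x‖ :=
  Matrix.l2_opNorm_mulVec A x

theorem norm_colVec_le (A : Matrix (Fin d) (Fin m) ℝ) (j : Fin m) : ‖colVec A j‖ ≤ ‖A‖ := by
  have := norm_toEuclideanLin_le A (EuclideanSpace.single j 1)
  rwa [← colVec_eq_toEuclideanLin_single, PiLp.norm_single, norm_one, mul_one] at this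

theorem norm_le_of_forall_toEuclideanLin_le {A : Matrix (Fin d) (Fin m) ℝ} {c : ℝ} (hc : 0 ≤ c)
    (h : ∀ x, ‖Matrix.toEuclideanLin A x‖ ≤ c * ‖x‖) : ‖A‖ ≤ c := by
  rw [Matrix.l2_opNorm_def]
  exact ContinuousLinearMap.opNorm_le_bound _ hc h

theorem mul_transpose_pow_mul (A : Matrix (Fin d) (Fin m) ℝ) (q : ℕ) :
    (A * Aᵀ) ^ q * A = A * (Aᵀ * A) ^ q := by
  induction q with
  | zero => simp
  | succ q ih => rw [pow_succ', Matrix.mul_assoc, ih, pow_succ']; simp only [Matrix.mul_assoc]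

theorem toEuclideanLin_power_mul (A : Matrix (Fin d) (Fin m) ℝ) (q : ℕ)
    (x : EuclideanSpace ℝ (Fin m)) :
    Matrix.toEuclideanLin ((A * Aᵀ) ^ q * A) x =
      Matrix.toEuclideanLin A ((((Matrix.toEuclideanLin A).adjoint ∘ₗ
        Matrix.toEuclideanLin A) ^ q) x) := by
  have h : (Matrix.toEuclideanLin A).adjoint ∘ₗ Matrix.toEuclideanLin A =
      Matrix.toEuclideanLin (Aᵀ * A) := by
    rw [← Matrix.toEuclideanLin_conjTranspose_eq_adjoint,
      Matrix.conjTranspose_eq_transpose_of_trivial]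
    exact (Matrix.toLpLin_mul_same _ _ _).symm
  rw [h, mul_transpose_pow_mul, ← Matrix.toLpLin_pow]
  exact congrArg (fun f => f x) (Matrix.toLpLin_mul_same 2 A ((Aᵀ * A) ^ q))

/-- The matrix that selects the columns with index in `I`. -/
def selection (I : Finset (Fin m)) : Matrix (Fin m) I ℝ :=
  (1 : Matrix (Fin m) (Fin m) ℝ).submatrix id (fun i : I => (i : Fin m))

theorem colSubmatrix_eq_mul (A : Matrix (Fin d) (Fin m) ℝ) (I : Finset (Fin m)) :
    colSubmatrix A I = A * selection I := by
  ext i j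
  simp [colSubmatrix, selection, Matrix.mul_apply, Matrix.one_apply]

theorem selection_mulVec_of_notMem (I : Finset (Fin m)) (w : I → ℝ) {j : Fin m}
    (hj : j ∉ I) : (selection I *ᵥ w) j = 0 := by
  simp only [Matrix.mulVec, dotProduct, selection, Matrix.submatrix_apply]
  refine Finset.sum_eq_zero fun i _ => ?_
  rw [Matrix.one_apply_ne, zero_mul]
  rintro rfl
  exact hj i.2

theorem selection_mulVec_injective (I : Finset (Fin m)) :
    Function.Injective (selection I).mulVec := by
  intro v w h
  ext i
  have := congrFun h i
  simpa [Matrix.mulVec, dotProduct, selection, Matrix.one_apply, Finset.sum_ite_eq,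
    ← Subtype.ext_iff] using this

/-- The vectors of `ℝ^m` supported on `I`, as the range of the selection matrix. -/
def supportedOn (I : Finset (Fin m)) : Submodule ℝ (EuclideanSpace ℝ (Fin m)) :=
  LinearMap.range ((WithLp.linearEquiv 2 ℝ (Fin m → ℝ)).symm.toLinearMap ∘ₗ
    (selection I).mulVecLin)

theorem mem_supportedOn {I : Finset (Fin m)} {x : EuclideanSpace ℝ (Fin m)} :
    x ∈ supportedOn I ↔
      ∃ w : I → ℝ, WithLp.toLp 2 (selection I *ᵥ w) = x :=
  Iff.rfl

theorem finrank_supportedOn (I : Finset (Fin m)) : finrank ℝ (supportedOn I) = I.card := by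
  rw [supportedOn, LinearMap.finrank_range_of_inj]
  · simp
  · exact (WithLp.linearEquiv 2 ℝ (Fin m → ℝ)).symm.injective.comp
      (selection_mulVec_injective I)

theorem power_mul_colSubmatrix (A : Matrix (Fin d) (Fin m) ℝ) (I : Finset (Fin m)) (q : ℕ) :
    (A * Aᵀ) ^ q * colSubmatrix A I = (A * Aᵀ) ^ q * A * selection I := by
  rw [colSubmatrix_eq_mul A, Matrix.mul_assoc]

/-- Multiplying by powers of `A Aᵀ` loses nothing on the range of `A`. -/
theorem mulVec_eq_zero_of_power_mul_mulVec_eq_zero (A : Matrix (Fin d) (Fin m) ℝ) (q : ℕ)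
    (v : Fin m → ℝ) (h : ((A * Aᵀ) ^ q * A) *ᵥ v = 0) : A *ᵥ v = 0 := by
  induction q generalizing v with
  | zero => simpa using h
  | succ q ih =>
    have h1 : ((A * Aᵀ) ^ q * A) *ᵥ ((Aᵀ * A) *ᵥ v) = 0 := by
      rw [Matrix.mulVec_mulVec, ← h, pow_succ]
      simp only [Matrix.mul_assoc]
    have h2 := ih _ h1
    have h3 : (Aᵀ * A) *ᵥ v = 0 := by
      have h4 := Matrix.self_mul_conjTranspose_mulVec_eq_zero A (A *ᵥ v)
      rw [Matrix.conjTranspose_eq_transpose_of_trivial] at h4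
      rw [← Matrix.mulVec_mulVec]
      refine h4.1 ?_
      rw [← h2, Matrix.mulVec_mulVec, Matrix.mulVec_mulVec, Matrix.mul_assoc]
    have h5 := Matrix.conjTranspose_mul_self_mulVec_eq_zero A v
    rw [Matrix.conjTranspose_eq_transpose_of_trivial] at h5
    exact h5.1 h3

/-! ### Orthogonal projection onto the range of the sketch -/

theorem mul_transpose_mul_eq_of_range_le {r : ℕ} {ι : Type*} [Fintype ι]
    {Q : Matrix (Fin d) (Fin r) ℝ} (hQ : Qᵀ * Q = 1) {Y : Matrix (Fin d) ι ℝ}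
    (hY : LinearMap.range Y.mulVecLin ≤ LinearMap.range Q.mulVecLin) : Q * Qᵀ * Y = Y := by
  classical
  rw [← Matrix.mulVec_injective.eq_iff]
  funext v
  obtain ⟨w, hw⟩ := hY ⟨v, rfl⟩
  simp only [Matrix.mulVecLin_apply] at hw
  rw [← Matrix.mulVec_mulVec, ← hw, Matrix.mulVec_mulVec, Matrix.mul_assoc, hQ, Matrix.mul_one]

theorem norm_one_sub_mul_transpose_le {r : ℕ} {Q : Matrix (Fin d) (Fin r) ℝ} (hQ : Qᵀ * Q = 1)
    (v : EuclideanSpace ℝ (Fin d)) : ‖Matrix.toEuclideanLin (1 - Q * Qᵀ) v‖ ≤ ‖v‖ := by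
  set u := Matrix.toEuclideanLin (1 - Q * Qᵀ) v with hu
  set p := Matrix.toEuclideanLin (Q * Qᵀ) v with hp
  have hv : v = u + p := by simp [hu, hp, map_sub]
  have hQ0 : (1 - Q * Qᵀ)ᵀ * (Q * Qᵀ) = 0 := by
    rw [Matrix.transpose_sub, Matrix.transpose_one, Matrix.transpose_mul,
      Matrix.transpose_transpose, Matrix.sub_mul, Matrix.one_mul, Matrix.mul_assoc,
      ← Matrix.mul_assoc Qᵀ, hQ, Matrix.one_mul, sub_self]
  have horth : inner ℝ u p = 0 := by
    rw [hu, hp, ← LinearMap.adjoint_inner_right, ← Matrix.toEuclideanLin_conjTranspose_eq_adjoint,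
      Matrix.conjTranspose_eq_transpose_of_trivial, ← LinearMap.comp_apply]
    have : Matrix.toEuclideanLin (1 - Q * Qᵀ)ᵀ ∘ₗ Matrix.toEuclideanLin (Q * Qᵀ) = 0 := by
      refine (Matrix.toLpLin_mul_same 2 _ _).symm.trans ?_
      rw [hQ0, map_zero]
    rw [this, LinearMap.zero_apply, inner_zero_right]
  have hpyth := norm_add_sq_eq_norm_sq_add_norm_sq_real horth
  rw [← hv] at hpyth
  refine le_of_sq_le_sq ?_ (norm_nonneg _)
  nlinarith [norm_nonneg p]

/-! ### Consequences of separability -/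

theorem IsSeparable.exists_weights {M : Matrix (Fin d) (Fin m) ℝ} {F : Matrix (Fin d) (Fin k) ℝ}
    (hM : IsSeparable M F) :
    ∃ h : Fin m → Fin k → ℝ, (∀ j i, 0 ≤ h j i) ∧ (∀ j, ∑ i, h j i ≤ 1) ∧
      (∀ j, colVec M j = ∑ i, h j i • colVec F i) ∧ ∀ i, ∃ j, colVec M j = colVec F i := by
  obtain ⟨-, H, e, h0, h1, rfl⟩ := hM
  have hcol : ∀ j, colVec (F * (Matrix.fromCols 1 H).submatrix id e.symm) j =
      ∑ i, (Matrix.fromCols 1 H) i (e.symm j) • colVec F i := fun j => by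
    ext l
    simp [colVec, Matrix.mul_apply, mul_comm]
  refine ⟨fun j i => (Matrix.fromCols 1 H) i (e.symm j), ?_, ?_, hcol, ?_⟩
  · intro j i
    dsimp only
    rcases e.symm j with a | a
    · simp only [Matrix.fromCols_apply_inl, Matrix.one_apply]
      split_ifs <;> norm_num
    · exact h0 i a
  · intro j
    dsimp only
    rcases e.symm j with a | a
    · simp [Matrix.one_apply]
    · exact h1 a
  · intro i
    refine ⟨e (Sum.inl i), ?_⟩
    rw [hcol]
    simp [Matrix.one_apply]

theorem IsSeparable.rank_le {M : Matrix (Fin d) (Fin m) ℝ} {F : Matrix (Fin d) (Fin k) ℝ}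
    (hM : IsSeparable M F) : M.rank ≤ k := by
  obtain ⟨hF, H, e, -, -, rfl⟩ := hM
  exact (Matrix.rank_mul_le_left _ _).trans hF.le

theorem sigmaMin_eq_of_rank_eq {F : Matrix (Fin d) (Fin k) ℝ} (hF : F.rank = k) :
    sigmaMin F = (Matrix.toEuclideanLin F).singularValues (k - 1) := by
  have : k ≤ d := by
    have := F.rank_le_height
    omega
  rw [sigmaMin, sigma, min_eq_right this]

theorem sigmaMin_pos {F : Matrix (Fin d) (Fin k) ℝ} (hk : 1 ≤ k) (hF : F.rank = k) :
    0 < sigmaMin F := by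
  rw [sigmaMin_eq_of_rank_eq hF, LinearMap.singularValues_pos_iff_lt_finrank_range,
    finrank_range_toEuclideanLin]
  omega

theorem sigmaMin_sq_mul_le {F : Matrix (Fin d) (Fin k) ℝ} (hF : F.rank = k) (x : Fin k → ℝ) :
    sigmaMin F ^ 2 * ∑ i, x i ^ 2 ≤ ‖∑ i, x i • colVec F i‖ ^ 2 := by
  have h := singularValues_last_mul_norm_le (Matrix.toEuclideanLin F) (WithLp.toLp 2 x)
  rw [finrank_euclideanSpace_fin, ← sigmaMin_eq_of_rank_eq hF, toEuclideanLin_eq_sum_colVec] at h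
  have h0 : 0 ≤ sigmaMin F := LinearMap.singularValues_nonneg _ _
  have h2 := pow_le_pow_left₀ (mul_nonneg h0 (norm_nonneg _)) h 2
  rw [mul_pow, EuclideanSpace.norm_sq_eq] at h2
  simpa using h2

theorem norm_colVec_le_sigmaMax (F : Matrix (Fin d) (Fin k) ℝ) (i : Fin k) :
    ‖colVec F i‖ ≤ sigmaMax F := by
  have h := norm_apply_le_singularValues_zero (Matrix.toEuclideanLin F)
    (EuclideanSpace.single i 1)
  rw [← colVec_eq_toEuclideanLin_single, PiLp.norm_single, norm_one, mul_one] at h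
  exact h

theorem sigmaMin_le_sigmaMax (F : Matrix (Fin d) (Fin k) ℝ) : sigmaMin F ≤ sigmaMax F :=
  LinearMap.singularValues_antitone _ (by omega)

/-- The smallness of the noise in the form used below. The factor `1 + 80 κ²` leaves room for the
error amplification `1 + 64/3 κ²` of the selection. -/
theorem noise_bounds (hk : 2 ≤ k) {ε σ κ : ℝ} (hε : 0 ≤ ε) (hσ : 0 < σ) (hκ : 1 ≤ κ)
    (h : ε < min (1 / (2 * Real.sqrt ((k : ℝ) - 1))) (1 / 4) * (σ / (1 + 80 * κ ^ 2))) :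
    k * (ε * (1 + 64 / 3 * κ ^ 2)) ^ 2 ≤ σ ^ 2 / 16 ∧ ε ≤ σ / 324 := by
  have hk' : (2 : ℝ) ≤ k := by exact_mod_cast hk
  have hκ2 : 1 ≤ κ ^ 2 := one_le_pow₀ hκ
  set μ := min (1 / (2 * Real.sqrt ((k : ℝ) - 1))) (1 / 4)
  have hs : 0 < Real.sqrt ((k : ℝ) - 1) := Real.sqrt_pos.2 (by linarith)
  have hμ0 : 0 < μ := lt_min (by positivity) (by norm_num)
  have hμ4 : μ ≤ 1 / 4 := min_le_right _ _
  have hμs : μ ≤ 1 / (2 * Real.sqrt ((k : ℝ) - 1)) := min_le_left _ _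
  have hμk : k * μ ^ 2 ≤ 1 / 2 := by
    have h1 : μ ^ 2 ≤ 1 / (4 * ((k : ℝ) - 1)) := by
      calc μ ^ 2 ≤ (1 / (2 * Real.sqrt ((k : ℝ) - 1))) ^ 2 := by gcongr
        _ = 1 / (4 * ((k : ℝ) - 1)) := by
          rw [div_pow, mul_pow, Real.sq_sqrt (by linarith)]; norm_num
    rw [le_div_iff₀ (by linarith)] at h1
    nlinarith [sq_nonneg μ]
  have hD : 0 < 1 + 80 * κ ^ 2 := by positivity
  have h2 : ε * (1 + 80 * κ ^ 2) ≤ μ * σ := by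
    rw [← mul_div_assoc, lt_div_iff₀ hD] at h
    exact h.le
  constructor
  · have h3 : ε * (1 + 64 / 3 * κ ^ 2) ≤ 3 / 10 * (μ * σ) := by
      have : ε * (1 + 64 / 3 * κ ^ 2) ≤ ε * (3 / 10 * (1 + 80 * κ ^ 2)) :=
        mul_le_mul_of_nonneg_left (by linarith) hε
      linarith
    calc k * (ε * (1 + 64 / 3 * κ ^ 2)) ^ 2 ≤ k * (3 / 10 * (μ * σ)) ^ 2 := by
          gcongr
      _ = 9 / 100 * (k * μ ^ 2) * σ ^ 2 := by ring
      _ ≤ 9 / 100 * (1 / 2) * σ ^ 2 := by gcongr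
      _ ≤ σ ^ 2 / 16 := by nlinarith [sq_nonneg σ]
  · nlinarith [mul_le_mul_of_nonneg_right hμ4 hσ.le, mul_le_mul_of_nonneg_left hκ2 hε]

/-- The columns selected by the algorithm are well conditioned, being close to a permutation of the
columns of `F`. -/
theorem IsSPAOutput.norm_le_norm_toEuclideanLin {A M N : Matrix (Fin d) (Fin m) ℝ}
    {F : Matrix (Fin d) (Fin k) ℝ} {I : Finset (Fin m)} (hk : 2 ≤ k) (hA : A = M + N)
    (hM : IsSeparable M F)
    (hδ : k * (‖N‖ * (1 + 64 / 3 * cond F ^ 2)) ^ 2 ≤ sigmaMin F ^ 2 / 16)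
    (hI : IsSPAOutput A k I) {c : EuclideanSpace ℝ (Fin m)} (hc : c ∈ supportedOn I) :
    3 / 4 * sigmaMin F * ‖c‖ ≤ ‖Matrix.toEuclideanLin A c‖ := by
  obtain ⟨hcard, S, hS⟩ := hI
  obtain ⟨h, h0, h1, hcol, hpure⟩ := hM.exists_weights
  have hσ : 0 < sigmaMin F := sigmaMin_pos (by omega) hM.1
  have hf := sigmaMin_sq_mul_le hM.1
  have hcolA : ∀ j, colVec A j - colVec M j = colVec N j := fun j => by
    ext i; simp [hA, colVec]
  obtain ⟨C, J, hIJ, hIC, hJ⟩ := hS.exists_labels (fun i => colVec F i) hσ (norm_nonneg N) rfl hδ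
    hf (norm_colVec_le_sigmaMax F) h h0 h1
    (fun j => by rw [← hcol, hcolA]; exact norm_colVec_le N j)
    (fun i => by
      obtain ⟨j, hj⟩ := hpure i
      exact ⟨j, by rw [← hj, hcolA]; exact norm_colVec_le N j⟩)
  obtain rfl : C = Finset.univ := by
    rw [← Finset.card_eq_iff_eq_univ, ← hIC, hcard, Fintype.card_fin]
  have hJinj : Set.InjOn J (Finset.univ : Finset (Fin k)) := by
    rw [← Finset.card_image_iff, ← hIJ, hIC]
  obtain ⟨w, rfl⟩ := mem_supportedOn.1 hc
  set c := WithLp.toLp 2 (selection I *ᵥ w)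
  have hc0 : ∀ j ∉ I, c j = 0 := fun j hj => selection_mulVec_of_notMem I w hj
  have hsum : Matrix.toEuclideanLin A c = ∑ i, c (J i) • colVec A (J i) := by
    rw [toEuclideanLin_eq_sum_colVec, ← Finset.sum_image (f := fun j => c j • colVec A j) hJinj,
      ← hIJ]
    exact (Finset.sum_subset (Finset.subset_univ I) fun j _ hj => by simp [hc0 j hj]).symm
  have hnorm : ‖c‖ ^ 2 = ∑ i, c (J i) ^ 2 := by
    rw [EuclideanSpace.norm_sq_eq, ← Finset.sum_image (f := fun j => c j ^ 2) hJinj, ← hIJ]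
    simp only [Real.norm_eq_abs, sq_abs]
    exact (Finset.sum_subset (Finset.subset_univ I) fun j _ hj => by simp [hc0 j hj]).symm
  have hlow : sigmaMin F * ‖c‖ ≤ ‖∑ i, c (J i) • colVec F i‖ := by
    refine le_of_sq_le_sq ?_ (norm_nonneg _)
    rw [mul_pow, hnorm]
    exact hf fun i => c (J i)
  have herr : ‖∑ i, c (J i) • (colVec A (J i) - colVec F i)‖ ≤ sigmaMin F / 4 * ‖c‖ := by
    refine le_of_sq_le_sq ?_ (by positivity)
    refine (norm_sum_smul_sq_le Finset.univ _ (fun i => c (J i)) hJ).trans ?_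
    rw [mul_pow _ ‖c‖, hnorm, Fintype.card_fin]
    refine mul_le_mul_of_nonneg_right (hδ.trans (le_of_eq (by ring)))
      (Finset.sum_nonneg fun i _ => sq_nonneg _)
  have hsplit : ∑ i, c (J i) • colVec F i =
      Matrix.toEuclideanLin A c - ∑ i, c (J i) • (colVec A (J i) - colVec F i) := by
    rw [hsum]
    simp only [smul_sub, Finset.sum_sub_distrib]
    abel
  have := norm_sub_le (Matrix.toEuclideanLin A c)
    (∑ i, c (J i) • (colVec A (J i) - colVec F i))
  rw [← hsplit] at this
  linarith

end Bridge

end SPA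

/-! ### Error and rank of the approximation -/

theorem mainTheorem1 {d m k q : ℕ} (hk : 2 ≤ k)
    (A M N : Matrix (Fin d) (Fin m) ℝ) (F : Matrix (Fin d) (Fin k) ℝ)
    (hA : A = M + N) (hM : SPA.IsSeparable M F)
    (hN : ‖N‖ < min (1 / (2 * Real.sqrt ((k : ℝ) - 1))) (1 / 4) *
      (SPA.sigmaMin F / (1 + 80 * SPA.cond F ^ 2)))
    (B : Matrix (Fin d) (Fin m) ℝ) (hB : SPA.IsApproxOutput A q k B) :
    (1 ≤ q → 0 < SPA.sigma A (k + 1) →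
      ‖A - B‖ < SPA.sigma A (k + 1) *
        Real.sqrt (1 + (1 / 20164) *
          (SPA.sigma A (k + 1) / SPA.sigma A k) ^ (4 * (q : ℤ) - 2))) ∧
    (SPA.sigma A (k + 1) = 0 → B = A) ∧
    B.rank = k := by
  obtain ⟨I, hI, r, Q, hQ, hrange, rfl⟩ := hB
  set T := Matrix.toEuclideanLin A
  set σ := SPA.sigmaMin F
  have hσ : 0 < σ := SPA.sigmaMin_pos (by omega) hM.1
  have hκ : 1 ≤ SPA.cond F := (one_le_div hσ).2 (SPA.sigmaMin_le_sigmaMax F)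
  obtain ⟨hδ, hε⟩ := SPA.noise_bounds hk (norm_nonneg N) hσ hκ hN
  have hlow : ∀ c ∈ SPA.supportedOn I, 3 / 4 * σ * ‖c‖ ≤ ‖T c‖ := fun c hc =>
    hI.norm_le_norm_toEuclideanLin hk hA hM hδ hc
  have hσk : T.singularValues k ≤ ‖N‖ := by
    refine SPA.singularValues_le_of_add (M := Matrix.toEuclideanLin M)
      (N := Matrix.toEuclideanLin N) (norm_nonneg N) ?_ ?_ (SPA.norm_toEuclideanLin_le N)
    · rw [← map_add, ← hA]
    · rw [SPA.finrank_range_toEuclideanLin]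
      exact hM.rank_le
  rw [SPA.power_mul_colSubmatrix] at hrange
  set E := SPA.selection I
  set Y := (A * Aᵀ) ^ q * A * E with hY
  have hQY : Q * Qᵀ * Y = Y := SPA.mul_transpose_mul_eq_of_range_le hQ hrange.ge
  have hYinj : Function.Injective Y.mulVecLin := by
    rw [← LinearMap.ker_eq_bot, Submodule.eq_bot_iff]
    intro w hw
    rw [LinearMap.mem_ker, Matrix.mulVecLin_apply, hY, ← Matrix.mulVec_mulVec] at hw
    have h1 := SPA.mulVec_eq_zero_of_power_mul_mulVec_eq_zero A q _ hw
    have h2 := hlow _ (SPA.mem_supportedOn.2 ⟨w, rfl⟩)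
    have h3 : T (WithLp.toLp 2 (E *ᵥ w)) = 0 := congrArg (WithLp.toLp 2) h1
    rw [h3, norm_zero] at h2
    have h4 : WithLp.toLp 2 (E *ᵥ w) = 0 := by
      rw [← norm_le_zero_iff]
      by_contra! hc
      have : 0 < 3 / 4 * σ * ‖WithLp.toLp 2 (E *ᵥ w)‖ := by positivity
      linarith
    have h5 : E *ᵥ w = E *ᵥ 0 := by
      rw [Matrix.mulVec_zero]
      exact congrArg WithLp.ofLp h4
    exact SPA.selection_mulVec_injective I h5
  have hYrank : Y.rank = k := by
    rw [Matrix.rank, LinearMap.finrank_range_of_inj hYinj]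
    simp [hI.1]
  have hYA : Y = A * ((Aᵀ * A) ^ q * E) := by
    rw [hY, SPA.mul_transpose_pow_mul, Matrix.mul_assoc]
  refine ⟨fun hq hpos => ?_, fun hzero => ?_, ?_⟩
  · obtain ⟨p, rfl⟩ : ∃ p, q = p + 1 := ⟨q - 1, by omega⟩
    change 0 < T.singularValues k at hpos
    change _ < T.singularValues k *
      Real.sqrt (1 + (1 / 20164) * (T.singularValues k / T.singularValues (k - 1)) ^ _)
    set β := T.singularValues k
    set α := T.singularValues (k - 1)
    have hα : 0 < α := hpos.trans_le (T.singularValues_antitone (by omega))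
    have hexp : (β / α) ^ (4 * ((p + 1 : ℕ) : ℤ) - 2) = (β ^ 2 / α ^ 2) ^ (2 * (p + 1) - 1) := by
      have h1 : (4 * ((p + 1 : ℕ) : ℤ) - 2) = ((2 * (2 * (p + 1) - 1) : ℕ) : ℤ) := by
        omega
      rw [h1, zpow_natCast, pow_mul, div_pow]
    rw [hexp]
    set x := (β ^ 2 / α ^ 2) ^ (2 * (p + 1) - 1)
    have hx : 0 < x := by positivity
    have hβ : β ≤ σ / 324 := hσk.trans hε
    have hβ2 : β ^ 2 ≤ (σ / 324) ^ 2 := by gcongr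
    have hle : ‖A - Q * Qᵀ * A‖ ≤ β * Real.sqrt (1 + 1 / 30000 * x) := by
      refine SPA.norm_le_of_forall_toEuclideanLin_le (by positivity) fun v => ?_
      -- `ρ = 1 / 30000` lies between `324⁻² / ((3 / 4) ^ 2 - 324⁻²)` and `1 / 20164`; the second gap
      -- makes the final inequality strict.
      obtain ⟨c, hc, hcv⟩ := SPA.exists_mem_norm_sub_iterate_sq_le T (SPA.supportedOn I)
        (by omega) hq ((SPA.finrank_supportedOn I).trans hI.1) (s := 3 / 4 * σ)
        (ρ := 1 / 30000) (by positivity) (by norm_num) hlow hpos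
        (by nlinarith [sq_nonneg σ]) v
      rw [← SPA.toEuclideanLin_power_mul] at hcv
      obtain ⟨w, rfl⟩ := SPA.mem_supportedOn.1 hc
      -- The iterate lies in the range of `Y`, so that the complementary projection kills it.
      have hres : Matrix.toEuclideanLin (A - Q * Qᵀ * A) v =
          Matrix.toEuclideanLin (1 - Q * Qᵀ) (T v -
            Matrix.toEuclideanLin ((A * Aᵀ) ^ (p + 1) * A) (WithLp.toLp 2 (E *ᵥ w))) := by
        have h1 : (1 - Q * Qᵀ) * Y = 0 := by
          rw [Matrix.sub_mul, hQY, Matrix.one_mul, sub_self]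
        have h2 : A - Q * Qᵀ * A = (1 - Q * Qᵀ) * A := by
          rw [Matrix.sub_mul, Matrix.one_mul]
        have h3 : Matrix.toEuclideanLin (1 - Q * Qᵀ)
            (Matrix.toEuclideanLin ((A * Aᵀ) ^ (p + 1) * A) (WithLp.toLp 2 (E *ᵥ w))) = 0 := by
          simp only [Matrix.toLpLin_apply, Matrix.mulVec_mulVec]
          rw [← hY, h1, Matrix.zero_mulVec]
          rfl
        rw [h2, map_sub _ (T v), h3, sub_zero]
        exact congrArg (fun f => f v) (Matrix.toLpLin_mul_same 2 (1 - Q * Qᵀ) A)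
      rw [hres]
      refine (SPA.norm_one_sub_mul_transpose_le hQ _).trans ?_
      refine le_of_sq_le_sq ?_ (by positivity)
      rw [mul_pow, mul_pow, Real.sq_sqrt (by positivity)]
      exact hcv
    refine hle.trans_lt (mul_lt_mul_of_pos_left (Real.sqrt_lt_sqrt (by positivity) ?_) hpos)
    linarith
  · have hrankA : A.rank ≤ k := by
      rw [← SPA.finrank_range_toEuclideanLin,
        ← LinearMap.singularValues_eq_zero_iff_le_finrank_range]
      exact hzero
    have hle : LinearMap.range Y.mulVecLin ≤ LinearMap.range A.mulVecLin := by
      rw [hYA, Matrix.mulVecLin_mul]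
      exact LinearMap.range_comp_le_range _ _
    have heq : LinearMap.range Y.mulVecLin = LinearMap.range A.mulVecLin :=
      Submodule.eq_of_le_of_finrank_le hle (hrankA.trans hYrank.ge)
    exact SPA.mul_transpose_mul_eq_of_range_le hQ (heq.symm.trans hrange.symm).le
  · refine le_antisymm ?_ ?_
    · calc (Q * Qᵀ * A).rank ≤ Q.rank := by
            rw [Matrix.mul_assoc]; exact Matrix.rank_mul_le_left _ _
        _ = Y.rank := by rw [Matrix.rank, Matrix.rank, hrange]
        _ = k := hYrank
    · calc k = (Q * Qᵀ * A * ((Aᵀ * A) ^ q * E)).rank := by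
            rw [Matrix.mul_assoc _ A, ← hYA, hQY, hYrank]
        _ ≤ (Q * Qᵀ * A).rank := Matrix.rank_mul_le_left _ _
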